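/- Let $a,b,h:[0,\infty)\to\mathbb R$ be Lebesgue measurable, and suppose that for constants $a_0,A,b_0,B,\tau$ with $a_0>0$, $b_0>0$ and for almost every $t\ge 0$ $$a_0\le a(t)\le A,\qquad b_0\le b(t)\le B,\qquad h(t)\le t,\qquad t-h(t)\le\tau .$$ Assume that at least one of the following conditions holds: 1) $B\le \dfrac{a_0^2}{4}$ and $\dfrac{a_0}{2}(A-a_0)<b_0-a_0B\tau$; 2) $b_0\ge \dfrac{a_0}{2}\left(A-\dfrac{a_0}{2}\right)$ and $B(1+a_0\tau)<\dfrac{a_0^2}{2}$. Consider the sunflower equation $$\ddot x(t)+a(t)\dot x(t)+b(t)\sin x(h(t))=0 .\qquad (*)$$ For $t_0\ge 0$ and bounded Borel functions $\varphi,\psi$ on $(-\infty,t_0]$, a solution of $(*)$ with initial data $(\varphi,\psi)$ at $t_0$ is a function $x:\mathbb R\to\mathbb R$, with velocity $\dot x$, such that $x=\varphi$ and $\dot x=\psi$ on $(-\infty,t_0]$ (the histories $\varphi$ and $\psi$ are independent data), $\dot x$ is the derivative of $x$ on $[t_0,\infty)$ (the right derivative at $t_0$) and is locally absolutely continuous there,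 and $(*)$ holds for almost every $t\ge t_0$. A constant $c$ is an equilibrium if $x\equiv c$ solves $(*)$. An equilibrium $c$ is locally asymptotically stable for the initial time $t_0$ if (i) for every $\varepsilon>0$ there is $\delta>0$ such that every solution whose initial data satisfy $|\varphi(t)-c|<\delta$ and $|\psi(t)|<\delta$ for all $t\le t_0$ satisfies $|x(t)-c|<\varepsilon$ and $|\dot x(t)|<\varepsilon$ for all $t\ge t_0$; and (ii) there is $\delta>0$ such that every solution whose initial data satisfy $|\varphi(t)-c|<\delta$ and $|\psi(t)|<\delta$ for all $t\le t_0$ satisfies $x(t)\to c$ and $\dot x(t)\to0$ as $t\to\infty$. Then for every integer $k$ the constants $2k\pi$ and $(2k+1)\pi$ are equilibria of $(*)$; for every initial time $t_0\ge0$, the equilibrium $2k\pi$ is locally asymptotically stable and the equilibrium $(2k+1)\pi$ is not locally asymptotically stable. -/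

import Mathlib

open MeasureTheory Filter Topology Set

namespace Sunflower

/-- Admissible initial data at time `t₀`: a pair of Borel functions, bounded on `(-∞, t₀]`. Only
the values on `(-∞, t₀]` matter; `φ` prescribes the position and `ψ` the velocity. -/
structure IsInitialData (t₀ : ℝ) (φ ψ : ℝ → ℝ) : Prop where
  measurable_pos : Measurable φ
  measurable_vel : Measurable ψ
  bounded_pos : ∃ M : ℝ, ∀ t ≤ t₀, |φ t| ≤ M
  bounded_vel : ∃ M : ℝ, ∀ t ≤ t₀, |ψ t| ≤ M

/-- `x`, with velocity `v`, is a global solution of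
`x''(t) + a(t) x'(t) + b(t) sin x(h(t)) = 0` for `t ≥ t₀`, with `x = φ` and `x' = ψ` for `t ≤ t₀`.
The position and velocity histories are independent data (no relation between `φ` and `ψ` is
required), so the velocity is recorded as a separate function: it is prescribed up to `t₀`, and it
is the derivative of `x` on `[t₀, ∞)` (the right derivative at `t₀`). It is locally absolutely
continuous on `[t₀, ∞)`, and the equation holds almost everywhere there. -/
structure IsSolution (a b h : ℝ → ℝ) (t₀ : ℝ) (φ ψ x v : ℝ → ℝ) : Prop where
  init_pos : ∀ t ≤ t₀, x t = φ t
  init_vel : ∀ t ≤ t₀, v t = ψ t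
  hasDeriv : ∀ t ≥ t₀, HasDerivWithinAt x (v t) (Ici t₀) t
  absCont : ∀ T ≥ t₀, AbsolutelyContinuousOnInterval v t₀ T
  equation : ∀ᵐ t ∂(volume.restrict (Ici t₀)),
    ∃ w : ℝ, HasDerivAt v w t ∧ w + a t * v t + b t * Real.sin (x (h t)) = 0

/-- The constant function `c` solves the equation from every initial time `t₀ ≥ 0`. -/
def IsEquilibrium (a b h : ℝ → ℝ) (c : ℝ) : Prop :=
  ∀ t₀ ≥ (0 : ℝ), IsSolution a b h t₀ (fun _ => c) (fun _ => 0) (fun _ => c) (fun _ => 0)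

/-- The initial data are within `δ` of the equilibrium state `(c, 0)` on `(-∞, t₀]`. -/
def IsNear (t₀ c δ : ℝ) (φ ψ : ℝ → ℝ) : Prop :=
  ∀ t ≤ t₀, |φ t - c| < δ ∧ |ψ t| < δ

/-- Lyapunov stability of the equilibrium `c`, for the initial time `t₀`. -/
def IsStable (a b h : ℝ → ℝ) (t₀ c : ℝ) : Prop :=
  ∀ ε > (0 : ℝ), ∃ δ > (0 : ℝ), ∀ φ ψ x v : ℝ → ℝ,
    IsInitialData t₀ φ ψ → IsNear t₀ c δ φ ψ → IsSolution a b h t₀ φ ψ x v →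
      ∀ t ≥ t₀, |x t - c| < ε ∧ |v t| < ε

/-- Local attractivity of the equilibrium `c`, for the initial time `t₀`. -/
def IsLocallyAttractive (a b h : ℝ → ℝ) (t₀ c : ℝ) : Prop :=
  ∃ δ > (0 : ℝ), ∀ φ ψ x v : ℝ → ℝ,
    IsInitialData t₀ φ ψ → IsNear t₀ c δ φ ψ → IsSolution a b h t₀ φ ψ x v →
      Tendsto x atTop (𝓝 c) ∧ Tendsto v atTop (𝓝 0)

/-- Local asymptotic stability of the equilibrium `c`, for the initial time `t₀`. -/
def IsLocallyAsymptoticallyStable (a b h : ℝ → ℝ) (t₀ c : ℝ) : Prop :=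
  IsStable a b h t₀ c ∧ IsLocallyAttractive a b h t₀ c

end Sunflower

namespace Sunflower

/-! ### Differential inequalities for absolutely continuous functions -/

/-! Even multiples of `π`. Put `s = a₀/2`, `u = x - c`, `y = x' + s u`, `z = u ∘ h`. The equation
becomes `u' = -s u + y` and `y' = -(a - s) y + f`, where `f = (s (a - s) - b) u + b (u - z) + b (z -
sin z)`. If `|y|` and `s |u|` are at most `M`, then `|x'| ≤ 2 M`, so the delay costs at most `2 B τ
M`, and the last term is cubic in `M`. Each of the two conditions makes the linear part of `f` at
most `q M (a - s)` with a fixed `q < 1` (`exists_margin`). Hence for small `M` the total forcing is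
at most `(1 + q)/2 · M (a - s)` (`abs_forcing_le`), and damping pulls `y`, then `u`, strictly inside
the level `M`. A first-exit argument gives stability (`IsSolution.forall_lt_of_isNear`); lowering
the level geometrically gives attraction (`IsSolution.exists_forall_ge_le_mul`).

Odd multiples of `π`. There the sine term repels. A solution released at rest at `c + d` cannot
return towards `c` while it stays close, so it does not converge to `c`
(`IsSolution.le_of_const_of_abs_lt_one`). Such a solution has to exist for this to refute anything;
it comes from a contraction in an exponentially weighted norm (`exists_weighted_velocity`). -/

theorem le_sub_mul_of_ae_hasDerivAt_le {g : ℝ → ℝ} {p q κ : ℝ} (hpq : p ≤ q)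
    (hg : AbsolutelyContinuousOnInterval g p q)
    (h : ∀ᵐ t, t ∈ Ioo p q → ∃ w, HasDerivAt g w t ∧ w ≤ -κ) :
    g q ≤ g p - κ * (q - p) := by
  have hint : ∫ t in p..q, deriv g t ≤ ∫ _ in p..q, -κ := by
    refine intervalIntegral.integral_mono_ae_restrict hpq hg.intervalIntegrable_deriv (by simp) ?_
    rw [EventuallyLE, ← restrict_Ioo_eq_restrict_Icc, ae_restrict_iff' measurableSet_Ioo]
    filter_upwards [h] with t ht hmem
    obtain ⟨w, hw, hle⟩ := ht hmem
    rwa [hw.deriv]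
  rw [hg.integral_deriv_eq_sub, intervalIntegral.integral_const, smul_eq_mul] at hint
  linarith

/-- If `g q > m`, look after the last time `s` with `g s ≤ m`: there `g` is above `m`, hence
nonincreasing, so `g q ≤ g s`. -/
theorem le_of_ae_hasDerivAt_nonpos_above {g : ℝ → ℝ} {p q m : ℝ} (hpq : p ≤ q)
    (hg : AbsolutelyContinuousOnInterval g p q) (hp : g p ≤ m)
    (h : ∀ᵐ t, t ∈ Ioo p q → m < g t → ∃ w, HasDerivAt g w t ∧ w ≤ 0) :
    g q ≤ m := by
  by_contra! hq
  have hcont : ContinuousOn g (Icc p q) := uIcc_of_le hpq ▸ hg.continuousOn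
  have hcpt : IsCompact (Icc p q ∩ g ⁻¹' Iic m) :=
    isCompact_Icc.of_isClosed_subset (hcont.preimage_isClosed_of_isClosed isClosed_Icc isClosed_Iic)
      inter_subset_left
  obtain ⟨s, ⟨hs, hsm⟩, hmax⟩ := hcpt.exists_isGreatest ⟨p, left_mem_Icc.2 hpq, hp⟩
  have habove : ∀ t ∈ Ioo s q, m < g t := fun t ht => by
    by_contra! hle
    exact absurd (hmax ⟨⟨hs.1.trans ht.1.le, ht.2.le⟩, hle⟩) (not_le.2 ht.1)
  have hsub : AbsolutelyContinuousOnInterval g s q :=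
    hg.mono (by rw [uIcc_of_le hs.2, uIcc_of_le hpq]; exact Icc_subset_Icc_left hs.1)
  have := le_sub_mul_of_ae_hasDerivAt_le (κ := 0) hs.2 hsub (by
    filter_upwards [h] with t ht hmem
    simpa using ht ⟨hs.1.trans_lt hmem.1, hmem.2⟩ (habove t hmem))
  have hsm' : g s ≤ m := hsm
  linarith

theorem exists_forall_ge_le_of_ae_hasDerivAt_le_above {g : ℝ → ℝ} {p m κ : ℝ} (hκ : 0 < κ)
    (hg : ∀ q ≥ p, AbsolutelyContinuousOnInterval g p q)
    (h : ∀ᵐ t, p < t → m < g t → ∃ w, HasDerivAt g w t ∧ w ≤ -κ) :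
    ∃ q ≥ p, ∀ t ≥ q, g t ≤ m := by
  have hsub : ∀ r ≥ p, ∀ q ≥ r, AbsolutelyContinuousOnInterval g r q := fun r hr q hq =>
    (hg q (hr.le.trans hq)).mono
      (by rw [uIcc_of_le hq, uIcc_of_le (hr.le.trans hq)]; exact Icc_subset_Icc_left hr)
  by_cases hex : ∃ r ≥ p, g r ≤ m
  · obtain ⟨r, hr, hrm⟩ := hex
    refine ⟨r, hr, fun t ht => le_of_ae_hasDerivAt_nonpos_above ht (hsub r hr t ht) hrm ?_⟩
    filter_upwards [h] with t ht hmem hm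
    obtain ⟨w, hw, hle⟩ := ht (lt_of_le_of_lt hr hmem.1) hm
    exact ⟨w, hw, by linarith⟩
  · push Not at hex
    exfalso
    have hgp := hex p le_rfl
    -- Descending at rate `κ` from `g p`, the level `m` is reached by this time at the latest.
    have hq : p ≤ p + (g p - m) / κ := by
      have := div_nonneg (sub_nonneg.2 hgp.le) hκ.le
      linarith
    have := le_sub_mul_of_ae_hasDerivAt_le (κ := κ) hq (hg _ hq) (by
      filter_upwards [h] with t ht hmem
      exact ht hmem.1 (hex t hmem.1.le))
    have hlast := hex _ hq
    rw [add_sub_cancel_left, mul_div_cancel₀ _ hκ.ne'] at this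
    linarith

/-- Encoding decay of `|g|` as a bound on `g g'` avoids differentiating the absolute value; this
splits it into one-sided statements for `g` and `-g`. -/
theorem exists_neg_of_mul_le {g : ℝ → ℝ} {κ t : ℝ} {w : ℝ} (hw : HasDerivAt g w t)
    (hle : g t * w ≤ -κ * |g t|) :
    (0 < g t → w ≤ -κ) ∧ (0 < -g t → HasDerivAt (-g) (-w) t ∧ -w ≤ -κ) := by
  refine ⟨fun h => ?_, fun h => ⟨hw.neg, ?_⟩⟩
  · rw [abs_of_pos h] at hle
    nlinarith
  · rw [abs_of_neg (by linarith)] at hle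
    nlinarith

theorem abs_le_of_ae_mul_hasDerivAt_nonpos {g : ℝ → ℝ} {p q m : ℝ} (hm : 0 ≤ m) (hpq : p ≤ q)
    (hg : AbsolutelyContinuousOnInterval g p q) (hp : |g p| ≤ m)
    (h : ∀ᵐ t, t ∈ Ioo p q → m < |g t| → ∃ w, HasDerivAt g w t ∧ g t * w ≤ 0) :
    |g q| ≤ m := by
  rw [abs_le] at hp
  refine abs_le'.2 ⟨le_of_ae_hasDerivAt_nonpos_above hpq hg hp.2 ?_,
    le_of_ae_hasDerivAt_nonpos_above (g := -g) hpq hg.neg (by simpa using neg_le.1 hp.1) ?_⟩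
  · filter_upwards [h] with t ht hmem hlt
    obtain ⟨w, hw, hle⟩ := ht hmem (hlt.trans_le (le_abs_self _))
    have := (exists_neg_of_mul_le (κ := 0) hw (by simpa using hle)).1 (hm.trans_lt hlt)
    exact ⟨w, hw, by simpa using this⟩
  · filter_upwards [h] with t ht hmem hlt
    obtain ⟨w, hw, hle⟩ := ht hmem (hlt.trans_le (neg_le_abs _))
    have := (exists_neg_of_mul_le (κ := 0) hw (by simpa using hle)).2 (hm.trans_lt hlt)
    exact ⟨-w, this.1, by simpa using this.2⟩

theorem exists_forall_ge_abs_le {g : ℝ → ℝ} {p m κ : ℝ} (hm : 0 ≤ m) (hκ : 0 < κ)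
    (hg : ∀ q ≥ p, AbsolutelyContinuousOnInterval g p q)
    (h : ∀ᵐ t, p < t → m < |g t| → ∃ w, HasDerivAt g w t ∧ g t * w ≤ -κ * |g t|) :
    ∃ q ≥ p, ∀ t ≥ q, |g t| ≤ m := by
  obtain ⟨q₁, hq₁, h₁⟩ := exists_forall_ge_le_of_ae_hasDerivAt_le_above (m := m) hκ hg (by
    filter_upwards [h] with t ht hmem hlt
    obtain ⟨w, hw, hle⟩ := ht hmem (hlt.trans_le (le_abs_self _))
    exact ⟨w, hw, (exists_neg_of_mul_le hw hle).1 (hm.trans_lt hlt)⟩)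
  obtain ⟨q₂, hq₂, h₂⟩ := exists_forall_ge_le_of_ae_hasDerivAt_le_above (g := -g) (m := m) hκ
    (fun q hq => (hg q hq).neg) (by
    filter_upwards [h] with t ht hmem hlt
    obtain ⟨w, hw, hle⟩ := ht hmem (hlt.trans_le (neg_le_abs _))
    exact ⟨-w, (exists_neg_of_mul_le hw hle).2 (hm.trans_lt hlt)⟩)
  exact ⟨max q₁ q₂, hq₁.le.trans (le_max_left _ _), fun t ht =>
    abs_le'.2 ⟨h₁ t ((le_max_left _ _).trans ht), h₂ t ((le_max_right _ _).trans ht)⟩⟩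

/-- A continuous function that cannot reach the level `M` for the first time stays below it. -/
theorem forall_lt_of_no_first_exit {G : ℝ → ℝ} {p M : ℝ} (hG : ContinuousOn G (Ici p))
    (h : ∀ q ≥ p, (∀ t ∈ Ico p q, G t < M) → G q < M) : ∀ t ≥ p, G t < M := by
  intro t ht
  by_contra! hM
  have hcpt : IsCompact (Icc p t ∩ G ⁻¹' Ici M) :=
    isCompact_Icc.of_isClosed_subset ((hG.mono Icc_subset_Ici_self).preimage_isClosed_of_isClosed
      isClosed_Icc isClosed_Ici) inter_subset_left
  obtain ⟨s, ⟨hs, hsM⟩, hmin⟩ := hcpt.exists_isLeast ⟨t, right_mem_Icc.2 ht, hM⟩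
  refine absurd (h s hs.1 fun r hr => ?_) (not_lt.2 hsM)
  by_contra! hle
  exact absurd (hmin ⟨⟨hr.1, hr.2.le.trans hs.2⟩, hle⟩) (not_le.2 hr.2)

theorem absolutelyContinuousOnInterval_of_hasDerivWithinAt {x v : ℝ → ℝ} {p q : ℝ} (hpq : p ≤ q)
    (hx : ∀ t ≥ p, HasDerivWithinAt x (v t) (Ici p) t) (hv : ContinuousOn v (Ici p)) :
    AbsolutelyContinuousOnInterval x p q := by
  obtain ⟨C, hC⟩ := isCompact_Icc.exists_bound_of_continuousOn
    (hv.mono (Icc_subset_Ici_self : Icc p q ⊆ Ici p))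
  have : LipschitzOnWith C.toNNReal x (uIcc p q) := by
    rw [uIcc_of_le hpq]
    refine (convex_Icc p q).lipschitzOnWith_of_nnnorm_hasDerivWithin_le
      (fun t ht => (hx t ht.1).mono Icc_subset_Ici_self) fun t ht => ?_
    rw [← NNReal.coe_le_coe, coe_nnnorm]
    exact (hC t ht).trans (Real.le_coe_toNNReal C)
  exact this.absolutelyContinuousOnInterval

theorem abs_sub_le_of_hasDerivWithinAt {x v : ℝ → ℝ} {p r q K : ℝ} (hpr : p ≤ r) (hrq : r ≤ q)
    (hx : ∀ t ≥ p, HasDerivWithinAt x (v t) (Ici p) t) (hv : ∀ t ∈ Ico r q, |v t| ≤ K) :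
    |x q - x r| ≤ K * (q - r) := by
  have := norm_image_sub_le_of_norm_deriv_right_le_segment (f := x) (f' := v) (a := r) (b := q)
    (C := K) (fun t ht => ((hx t (hpr.trans ht.1)).continuousWithinAt.mono
      (Icc_subset_Ici_self.trans (Ici_subset_Ici.2 hpr))))
    (fun t ht => (hx t (hpr.trans ht.1)).mono (Ici_subset_Ici.2 (hpr.trans ht.1)))
    (fun t ht => hv t ht) q (right_mem_Icc.2 hrq)
  simpa using this

/-! ### Stability of the even multiples of `π` -/

/-- Almost everywhere on `[t₀, ∞)`, in the coordinates `u = x - c`, `y = x' + s u` the equation is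
damped with rate `a - s ≥ s`, and the forcing of `y` by the linear terms is at most the fraction `q`
of that rate. -/
structure IsContractive (a b h : ℝ → ℝ) (s B τ q t₀ : ℝ) : Prop where
  s_pos : 0 < s
  B_nonneg : 0 ≤ B
  τ_nonneg : 0 ≤ τ
  q_nonneg : 0 ≤ q
  q_lt_one : q < 1
  ae_bounds : ∀ᵐ t, t₀ ≤ t → s ≤ a t - s ∧ 0 ≤ b t ∧ b t ≤ B ∧
    |s * (a t - s) - b t| / s + 2 * B * τ ≤ q * (a t - s) ∧ h t ≤ t ∧ t - h t ≤ τ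

/-- The linear terms use the fraction `q` of `M α`. The remaining slack `(1 - q) M α` is at least
`(1 - q) M s`; a quarter of it pays for the error `e` and a quarter for the cubic remainder of the
sine. -/
theorem abs_forcing_le {s α β B τ q M e u z : ℝ} (hs : 0 < s) (hα : s ≤ α) (hβ₀ : 0 ≤ β)
    (hβ : β ≤ B) (hq : |s * α - β| / s + 2 * B * τ ≤ q * α) (hq₁ : q < 1) (hM : 0 ≤ M)
    (hu : s * |u| ≤ M) (hz : s * |z| ≤ M) (huz : |u - z| ≤ 2 * M * τ + e)
    (hMB : B * M ^ 2 ≤ s ^ 4 * (1 - q) / 4) (he : B * e ≤ s * (1 - q) / 4 * M) :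
    |(s * α - β) * u + β * (u - z) + β * (z - Real.sin z)| ≤ (1 + q) / 2 * M * α := by
  have hB : 0 ≤ B := hβ₀.trans hβ
  have hu' : |u| ≤ M / s := by rw [le_div_iff₀ hs]; linarith
  have hz' : |z| ≤ M / s := by rw [le_div_iff₀ hs]; linarith
  have h₁ : |(s * α - β) * u| ≤ |s * α - β| / s * M := by
    rw [abs_mul, div_mul_eq_mul_div, mul_div_assoc]
    gcongr
  have h₂ : |β * (u - z)| ≤ B * (2 * M * τ + e) := by
    rw [abs_mul, abs_of_nonneg hβ₀]
    exact mul_le_mul hβ huz (abs_nonneg _) hB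
  have h₃ : |β * (z - Real.sin z)| ≤ s * (1 - q) / 4 * M := by
    have hcub : |z - Real.sin z| ≤ (M / s) ^ 3 :=
      calc |z - Real.sin z| ≤ |z| ^ 3 / 6 := Real.abs_sub_sin_le z
        _ ≤ |z| ^ 3 := by linarith [pow_nonneg (abs_nonneg z) 3]
        _ ≤ (M / s) ^ 3 := by gcongr
    rw [abs_mul, abs_of_nonneg hβ₀]
    calc β * |z - Real.sin z| ≤ B * (M / s) ^ 3 := mul_le_mul hβ hcub (abs_nonneg _) hB
      _ = B * M ^ 2 * (M / s ^ 3) := by field_simp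
      _ ≤ s ^ 4 * (1 - q) / 4 * (M / s ^ 3) := by gcongr
      _ = s * (1 - q) / 4 * M := by field_simp
  have h₄ := (abs_add_three ((s * α - β) * u) (β * (u - z)) (β * (z - Real.sin z)))
  have h₅ := mul_le_mul_of_nonneg_right hq hM
  have h₆ : (1 - q) / 2 * M * s ≤ (1 - q) / 2 * M * α := by
    have : 0 ≤ (1 - q) / 2 * M := mul_nonneg (by linarith) hM
    gcongr
  nlinarith

variable {a b h φ ψ x v : ℝ → ℝ} {s B τ q t₀ c M : ℝ}

theorem IsSolution.continuousOn_vel (hx : IsSolution a b h t₀ φ ψ x v) :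
    ContinuousOn v (Ici t₀) := fun t ht => by
  have hcont := (hx.absCont (t + 1) (by linarith [mem_Ici.1 ht])).continuousOn
  rw [uIcc_of_le (by linarith [mem_Ici.1 ht])] at hcont
  refine (hcont t ⟨ht, by linarith⟩).mono_of_mem_nhdsWithin ?_
  rw [← Ici_inter_Iic]
  exact inter_mem_nhdsWithin _ (Iic_mem_nhds (by linarith))

theorem IsSolution.continuousOn_pos (hx : IsSolution a b h t₀ φ ψ x v) :
    ContinuousOn x (Ici t₀) := fun t ht => (hx.hasDeriv t ht).continuousWithinAt

theorem IsSolution.absCont_pos (hx : IsSolution a b h t₀ φ ψ x v) {T : ℝ} (hT : t₀ ≤ T) :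
    AbsolutelyContinuousOnInterval x t₀ T :=
  absolutelyContinuousOnInterval_of_hasDerivWithinAt hT hx.hasDeriv hx.continuousOn_vel

theorem IsSolution.hasDerivAt_pos (hx : IsSolution a b h t₀ φ ψ x v) {t : ℝ} (ht : t₀ < t) :
    HasDerivAt x (v t) t := (hx.hasDeriv t ht.le).hasDerivAt (Ici_mem_nhds ht)

theorem _root_.AbsolutelyContinuousOnInterval.sub_const {f : ℝ → ℝ} {p r : ℝ}
    (hf : AbsolutelyContinuousOnInterval f p r) (k : ℝ) :
    AbsolutelyContinuousOnInterval (fun t => f t - k) p r := by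
  simpa [AbsolutelyContinuousOnInterval] using hf

theorem _root_.AbsolutelyContinuousOnInterval.mono_left {f : ℝ → ℝ} {p p' r : ℝ}
    (hf : AbsolutelyContinuousOnInterval f p r) (hp : p ≤ p') (hr : p' ≤ r) :
    AbsolutelyContinuousOnInterval f p' r :=
  hf.mono (by rw [uIcc_of_le hr, uIcc_of_le (hp.trans hr)]; exact Icc_subset_Icc_left hp)

theorem IsSolution.absCont_shifted (hx : IsSolution a b h t₀ φ ψ x v) (s c : ℝ) {p T : ℝ}
    (hp : t₀ ≤ p) (hT : p ≤ T) :
    AbsolutelyContinuousOnInterval (fun t => v t + s * (x t - c)) p T :=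
  ((hx.absCont T (hp.trans hT)).fun_add
    (((hx.absCont_pos (hp.trans hT)).sub_const c).const_mul s)).mono_left hp hT

/-- The damped differential inequality for `y = x' + s (x - c)`, at a time where the state, now and
at the delayed time, is within the level `M`. -/
theorem IsSolution.ae_damped (hx : IsSolution a b h t₀ φ ψ x v)
    (hC : IsContractive a b h s B τ q t₀) (hc : ∀ y, Real.sin y = Real.sin (y - c))
    (hM : 0 ≤ M) (hMB : B * M ^ 2 ≤ s ^ 4 * (1 - q) / 4) {e : ℝ}
    (he : B * e ≤ s * (1 - q) / 4 * M) :
    ∀ᵐ t, t₀ < t → h t ≤ t ∧ t - h t ≤ τ ∧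
      (s * |x t - c| ≤ M → s * |x (h t) - c| ≤ M → |x t - x (h t)| ≤ 2 * M * τ + e →
        ∃ w, HasDerivAt (fun t => v t + s * (x t - c)) w t ∧
          ∀ m, (1 + q) / 2 * M ≤ m → m < |v t + s * (x t - c)| →
            (v t + s * (x t - c)) * w ≤
              -(s * (m - (1 + q) / 2 * M)) * |v t + s * (x t - c)|) := by
  have heq := hx.equation
  rw [ae_restrict_iff' measurableSet_Ici] at heq
  filter_upwards [heq, hC.ae_bounds] with t heqt hbt ht
  obtain ⟨hα, hβ₀, hβ, hq, hht, hτ⟩ := hbt ht.le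
  obtain ⟨w, hw, hweq⟩ := heqt ht.le
  refine ⟨hht, hτ, fun hu hz huz => ⟨w + s * v t, ?_, fun m hm hlt => ?_⟩⟩
  · exact hw.add (((hx.hasDerivAt_pos ht).sub_const c).const_mul s)
  · have hf := abs_forcing_le hC.s_pos hα hβ₀ hβ hq hC.q_lt_one hM hu hz
      (by simpa using huz) hMB he
    set f := (s * (a t - s) - b t) * (x t - c) + b t * (x t - c - (x (h t) - c)) +
      b t * (x (h t) - c - Real.sin (x (h t) - c)) with hfdef
    set y := v t + s * (x t - c) with hy
    have hws : w + s * v t = -(a t - s) * y + f := by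
      rw [hc (x (h t))] at hweq
      rw [hfdef, hy]
      linear_combination hweq
    have hyf : y * f ≤ |y| * ((1 + q) / 2 * M * (a t - s)) :=
      (le_abs_self _).trans (by rw [abs_mul]; gcongr)
    have hsq : y * y = |y| * |y| := (abs_mul_abs_self y).symm
    -- The level `m` is kept free: `m = (1 + q)/2 · M` gives mere nonincrease, a larger `m` a strict
    -- rate of descent.
    have h₁ : s * (m - (1 + q) / 2 * M) ≤ (a t - s) * (|y| - (1 + q) / 2 * M) :=
      mul_le_mul hα (by linarith) (by linarith) (hC.s_pos.le.trans hα)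
    have h₂ := mul_le_mul_of_nonneg_right h₁ (abs_nonneg y)
    have h₃ : y * (-(a t - s) * y + f) = -(a t - s) * (|y| * |y|) + y * f := by
      linear_combination -(a t - s) * hsq
    rw [hws, h₃]
    linarith

/-- Since `u' = y - s u`, a bound `m` on `|y|` drives `s |u|` down to any level `m' > m`. -/
theorem mul_sub_le_of_abs_le {s u y m m' : ℝ} (hs : 0 < s) (hy : |y| ≤ m) (hm : m' / s < |u|) :
    u * (y - s * u) ≤ -(m' - m) * |u| := by
  have hm' : m' < s * |u| := by rw [div_lt_iff₀ hs] at hm; linarith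
  have h₁ : u * y ≤ |u| * m := (le_abs_self _).trans (by rw [abs_mul]; gcongr)
  have h₂ : u * u = |u| * |u| := (abs_mul_abs_self u).symm
  have h₃ := mul_le_mul_of_nonneg_right hm'.le (abs_nonneg u)
  nlinarith

theorem abs_vel_le {s u v M : ℝ} (hs : 0 < s) (hy : |v + s * u| ≤ M) (hu : s * |u| ≤ M) :
    |v| ≤ 2 * M := by
  have : |v| ≤ |v + s * u| + |s * u| := by simpa using abs_sub (v + s * u) (s * u)
  rw [abs_mul, abs_of_pos hs] at this
  linarith

/-- Solutions starting within `δ` of the equilibrium remain within the level `M`. -/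
theorem IsSolution.forall_lt_of_isNear (hx : IsSolution a b h t₀ φ ψ x v)
    (hC : IsContractive a b h s B τ q t₀) (hc : ∀ y, Real.sin y = Real.sin (y - c))
    (hM : 0 < M) (hMB : B * M ^ 2 ≤ s ^ 4 * (1 - q) / 4) {δ : ℝ}
    (hδB : B * (2 * δ) ≤ s * (1 - q) / 4 * M) (hδ : δ * (1 + s) ≤ (1 + q) / 2 * M)
    (hnear : IsNear t₀ c δ φ ψ) :
    ∀ t ≥ t₀, |v t + s * (x t - c)| < M ∧ s * |x t - c| < M := by
  have hs := hC.s_pos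
  have hq0 := hC.q_nonneg
  have hq1 := hC.q_lt_one
  have hnx : ∀ t ≤ t₀, |x t - c| < δ := fun t ht => by rw [hx.init_pos t ht]; exact (hnear t ht).1
  have hnv : |v t₀| < δ := by rw [hx.init_vel t₀ le_rfl]; exact (hnear t₀ le_rfl).2
  have hδ0 : 0 < δ := (abs_nonneg _).trans_lt hnv
  have hmM : (1 + q) / 2 * M < M := mul_lt_of_lt_one_left hM (by linarith)
  have hm0 : 0 ≤ (1 + q) / 2 * M := by positivity
  have hsδ : s * δ ≤ (1 + q) / 2 * M := by linarith
  have hcont : ContinuousOn (fun t => max |v t + s * (x t - c)| (s * |x t - c|)) (Ici t₀) := by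
    have h₁ := hx.continuousOn_vel
    have h₂ := hx.continuousOn_pos
    fun_prop
  have key := forall_lt_of_no_first_exit (M := M) hcont ?_
  · exact fun t ht => max_lt_iff.1 (key t ht)
  intro r hr hlt
  replace hlt : ∀ t ∈ Ico t₀ r, |v t + s * (x t - c)| < M ∧ s * |x t - c| < M :=
    fun t ht => max_lt_iff.1 (hlt t ht)
  have hvel : ∀ t ∈ Ico t₀ r, |v t| ≤ 2 * M := fun t ht =>
    abs_vel_le hs (hlt t ht).1.le (hlt t ht).2.le
  -- Up to the putative exit time `r`, the bound on `y` improves from `M` to `(1 + q)/2 · M`; the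
  -- bound on `u` then inherits it.
  have hy : ∀ r' ∈ Icc t₀ r, |v r' + s * (x r' - c)| ≤ (1 + q) / 2 * M := by
    intro r' hr'
    refine abs_le_of_ae_mul_hasDerivAt_nonpos (g := fun t => v t + s * (x t - c)) hm0 hr'.1
      (hx.absCont_shifted s c le_rfl hr'.1) ?_ ?_
    · have h₁ := abs_add_le (v t₀) (s * (x t₀ - c))
      rw [abs_mul, abs_of_pos hs] at h₁
      have h₂ := mul_lt_mul_of_pos_left (hnx t₀ le_rfl) hs
      linarith
    · filter_upwards [hx.ae_damped hC hc hM.le hMB hδB] with t hdamp hmem hgt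
      have htr : t ∈ Ico t₀ r := ⟨hmem.1.le, hmem.2.trans_le hr'.2⟩
      obtain ⟨hht, hτ, hd⟩ := hdamp hmem.1
      have hd' := hd (hlt t htr).2.le
      rcases le_or_gt t₀ (h t) with hh | hh
      · have hdiff := abs_sub_le_of_hasDerivWithinAt (K := 2 * M) hh hht hx.hasDeriv
          (fun p hp => hvel p ⟨hh.trans hp.1, hp.2.trans htr.2⟩)
        obtain ⟨w, hw, hle⟩ := hd' (hlt (h t) ⟨hh, hht.trans_lt htr.2⟩).2.le
          (by linarith [mul_le_mul_of_nonneg_left hτ (by positivity : 0 ≤ 2 * M)])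
        exact ⟨w, hw, by simpa using hle _ le_rfl hgt⟩
      -- The delayed time lies in the history, where position and velocity are unrelated. The
      -- velocity bound applies only on `[t₀, t]`; the gap between `x (h t)` and `x t₀` costs `2 δ`,
      -- which is the error `e`.
      · have hdiff := abs_sub_le_of_hasDerivWithinAt (K := 2 * M) le_rfl hmem.1.le hx.hasDeriv
          (fun p hp => hvel p ⟨hp.1, hp.2.trans htr.2⟩)
        have hnh := hnx (h t) hh.le
        obtain ⟨w, hw, hle⟩ := hd' (by linarith [mul_lt_mul_of_pos_left hnh hs]) (by
          have h₁ : |x t - x (h t)| ≤ |x t - x t₀| + (|x t₀ - c| + |x (h t) - c|) := by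
            have e₁ := abs_sub_le (x t) (x t₀) (x (h t))
            have e₂ := abs_sub_le (x t₀) c (x (h t))
            rw [abs_sub_comm c] at e₂
            linarith
          have h₂ := hnx t₀ le_rfl
          have h₃ : 2 * M * (t - t₀) ≤ 2 * M * τ := by
            gcongr
            linarith
          linarith)
        exact ⟨w, hw, by simpa using hle _ le_rfl hgt⟩
  have hu : |x r - c| ≤ (1 + q) / 2 * M / s := by
    refine abs_le_of_ae_mul_hasDerivAt_nonpos (g := fun t => x t - c) (by positivity) hr
      ((hx.absCont_pos hr).sub_const c) ?_ (Eventually.of_forall fun t ht hgt => ?_)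
    · rw [le_div_iff₀ hs]
      linarith [mul_lt_mul_of_pos_left (hnx t₀ le_rfl) hs]
    · refine ⟨v t, (hx.hasDerivAt_pos ht.1).sub_const c, ?_⟩
      simpa using mul_sub_le_of_abs_le hs (hy t ⟨ht.1.le, ht.2.le⟩) hgt
  refine max_lt ((hy r ⟨hr, le_rfl⟩).trans_lt hmM) ?_
  rw [le_div_iff₀ hs] at hu
  linarith

/-- A level that bounds the state from some time on can be lowered by a fixed factor. -/
theorem IsSolution.exists_forall_ge_le_mul (hx : IsSolution a b h t₀ φ ψ x v)
    (hC : IsContractive a b h s B τ q t₀) (hc : ∀ y, Real.sin y = Real.sin (y - c))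
    (hM : 0 < M) (hMB : B * M ^ 2 ≤ s ^ 4 * (1 - q) / 4) {T : ℝ} (hT : t₀ ≤ T)
    (hbd : ∀ t ≥ T, |v t + s * (x t - c)| ≤ M ∧ s * |x t - c| ≤ M) :
    ∃ T' ≥ T, ∀ t ≥ T', |v t + s * (x t - c)| ≤ (7 + q) / 8 * M ∧
      s * |x t - c| ≤ (7 + q) / 8 * M := by
  have hs := hC.s_pos
  have hq0 := hC.q_nonneg
  have hq1 := hC.q_lt_one
  have hτ0 := hC.τ_nonneg
  have hqM : 0 < (1 - q) * M := mul_pos (by linarith) hM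
  have hTτ : t₀ ≤ T + τ := by linarith
  -- From `T + τ` on, delayed times are past `T`, so `e = 0`. The levels `(3 + q)/4` for `y` and `(7
  -- + q)/8` for `u` are successive midpoints between `(1 + q)/2` and `1`, leaving a positive rate
  -- at each stage.
  obtain ⟨T₁, hT₁, hy⟩ := exists_forall_ge_abs_le (g := fun t => v t + s * (x t - c))
    (p := T + τ) (m := (3 + q) / 4 * M) (κ := s * ((3 + q) / 4 * M - (1 + q) / 2 * M))
    (by positivity) (mul_pos hs (by linarith))
    (fun r hr => hx.absCont_shifted s c hTτ hr) (by
      filter_upwards [hx.ae_damped hC hc hM.le hMB (e := 0) (by simp; positivity)]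
        with t hdamp ht hgt
      obtain ⟨hht, hτ, hd⟩ := hdamp (hTτ.trans_lt ht)
      have hTh : T ≤ h t := by linarith
      have hdiff := abs_sub_le_of_hasDerivWithinAt (K := 2 * M) (hT.trans hTh) hht hx.hasDeriv
        (fun p hp => abs_vel_le hs (hbd p (hTh.trans hp.1)).1 (hbd p (hTh.trans hp.1)).2)
      obtain ⟨w, hw, hle⟩ := hd (hbd t (by linarith)).2 (hbd _ hTh).2
        (by linarith [mul_le_mul_of_nonneg_left hτ (by positivity : 0 ≤ 2 * M)])
      exact ⟨w, hw, hle _ (by linarith) hgt⟩)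
  have hT₁' : T ≤ T₁ := by linarith
  obtain ⟨T₂, hT₂, hu⟩ := exists_forall_ge_abs_le (g := fun t => x t - c)
    (p := T₁) (m := (7 + q) / 8 * M / s) (κ := (7 + q) / 8 * M - (3 + q) / 4 * M)
    (by positivity) (by linarith)
    (fun r hr => ((hx.absCont_pos ((hT.trans hT₁').trans hr)).sub_const c).mono_left
      (hT.trans hT₁') hr)
    (Eventually.of_forall fun t ht hgt => by
      refine ⟨v t, (hx.hasDerivAt_pos ((hT.trans hT₁').trans_lt ht)).sub_const c, ?_⟩
      simpa using mul_sub_le_of_abs_le hs (hy t ht.le) hgt)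
  refine ⟨T₂, hT₁'.trans hT₂, fun t ht => ⟨(hy t (le_trans hT₂ ht)).trans (by linarith), ?_⟩⟩
  have := hu t ht
  rw [le_div_iff₀ hs] at this
  linarith

/-- The smallness condition on `M` persists for lower levels, so the reduction by the factor `(7 +
q)/8 < 1` can be iterated. -/
theorem IsSolution.tendsto_of_forall_le (hx : IsSolution a b h t₀ φ ψ x v)
    (hC : IsContractive a b h s B τ q t₀) (hc : ∀ y, Real.sin y = Real.sin (y - c))
    (hM : 0 < M) (hMB : B * M ^ 2 ≤ s ^ 4 * (1 - q) / 4)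
    (hbd : ∀ t ≥ t₀, |v t + s * (x t - c)| ≤ M ∧ s * |x t - c| ≤ M) :
    Tendsto x atTop (𝓝 c) ∧ Tendsto v atTop (𝓝 0) := by
  have hs := hC.s_pos
  have hq0 := hC.q_nonneg
  have hq1 := hC.q_lt_one
  have hB := hC.B_nonneg
  have hiter : ∀ n : ℕ, ∃ T ≥ t₀, ∀ t ≥ T, |v t + s * (x t - c)| ≤ ((7 + q) / 8) ^ n * M ∧
      s * |x t - c| ≤ ((7 + q) / 8) ^ n * M := by
    intro n
    induction n with
    | zero => exact ⟨t₀, le_rfl, by simpa using hbd⟩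
    | succ n ih =>
      obtain ⟨T, hT, hbdT⟩ := ih
      have hle : ((7 + q) / 8) ^ n * M ≤ M :=
        mul_le_of_le_one_left hM.le (pow_le_one₀ (by positivity) (by linarith))
      obtain ⟨T', hT', hbdT'⟩ := hx.exists_forall_ge_le_mul hC hc (by positivity)
        (le_trans (by gcongr) hMB) hT hbdT
      refine ⟨T', hT.le.trans hT', fun t ht => ?_⟩
      rw [pow_succ', mul_assoc]
      exact hbdT' t ht
  have hsmall : ∀ ε > 0, ∃ T, ∀ t ≥ T, |v t + s * (x t - c)| < ε ∧ s * |x t - c| < ε := by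
    intro ε hε
    have hlim : Tendsto (fun n : ℕ => ((7 + q) / 8) ^ n * M) atTop (𝓝 0) := by
      simpa using (tendsto_pow_atTop_nhds_zero_of_lt_one (by positivity)
        (by linarith : (7 + q) / 8 < 1)).mul_const M
    obtain ⟨n, hn⟩ := (hlim.eventually (gt_mem_nhds hε)).exists
    obtain ⟨T, -, hT⟩ := hiter n
    exact ⟨T, fun t ht => ⟨(hT t ht).1.trans_lt hn, (hT t ht).2.trans_lt hn⟩⟩
  constructor <;> refine Metric.tendsto_atTop.2 fun ε hε => ?_
  · obtain ⟨T, hT⟩ := hsmall (s * ε) (by positivity)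
    exact ⟨T, fun t ht => lt_of_mul_lt_mul_left (hT t ht).2 hs.le⟩
  · obtain ⟨T, hT⟩ := hsmall (ε / 3) (by positivity)
    refine ⟨T, fun t ht => ?_⟩
    have := abs_vel_le hs (hT t ht).1.le (hT t ht).2.le
    rw [Real.dist_eq, sub_zero]
    linarith

theorem IsContractive.exists_pos_forall_small (hC : IsContractive a b h s B τ q t₀) {ε : ℝ}
    (hε : 0 < ε) : ∃ M > 0, B * M ^ 2 ≤ s ^ 4 * (1 - q) / 4 ∧ M ≤ ε ∧
      ∃ δ > 0, B * (2 * δ) ≤ s * (1 - q) / 4 * M ∧ δ * (1 + s) ≤ (1 + q) / 2 * M := by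
  have hs := hC.s_pos
  have hq0 := hC.q_nonneg
  have hq1 : 0 < 1 - q := by linarith [hC.q_lt_one]
  have aux : ∀ f : ℝ → ℝ, Continuous f → f 0 = 0 → ∀ k > 0, ∀ᶠ r in 𝓝[>] (0 : ℝ), f r ≤ k :=
    fun f hf h0 k hk => by
      have : Tendsto f (𝓝[>] 0) (𝓝 0) := by
        simpa [h0] using (hf.tendsto 0).mono_left nhdsWithin_le_nhds
      exact (this.eventually (gt_mem_nhds hk)).mono fun _ => le_of_lt
  obtain ⟨M, hM₁, hM₂, hM⟩ := ((aux (fun M => B * M ^ 2) (by fun_prop) (by simp)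
    (s ^ 4 * (1 - q) / 4) (by positivity)).and ((aux id continuous_id rfl ε hε).and
    self_mem_nhdsWithin)).exists
  have hM : 0 < M := hM
  obtain ⟨δ, hδ₁, hδ₂, hδ⟩ := ((aux (fun δ => B * (2 * δ)) (by fun_prop) (by simp)
    (s * (1 - q) / 4 * M) (by positivity)).and ((aux (fun δ => δ * (1 + s)) (by fun_prop) (by simp)
    ((1 + q) / 2 * M) (by positivity)).and self_mem_nhdsWithin)).exists
  exact ⟨M, hM, hM₁, hM₂, δ, hδ, hδ₁, hδ₂⟩

theorem IsContractive.isLocallyAsymptoticallyStable (hC : IsContractive a b h s B τ q t₀)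
    (hc : ∀ y, Real.sin y = Real.sin (y - c)) : IsLocallyAsymptoticallyStable a b h t₀ c := by
  have hs := hC.s_pos
  refine ⟨fun ε hε => ?_, ?_⟩
  -- `M ≤ s ε` controls the position; `M ≤ ε / 3` controls the velocity, which is at most `2 M`.
  · obtain ⟨M, hM, hMB, hMε, δ, hδ, hδB, hδM⟩ := hC.exists_pos_forall_small
      (lt_min (mul_pos hs hε) (by linarith : 0 < ε / 3))
    refine ⟨δ, hδ, fun φ ψ x v _ hnear hx t ht => ?_⟩
    obtain ⟨hy, hu⟩ := hx.forall_lt_of_isNear hC hc hM hMB hδB hδM hnear t ht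
    have := abs_vel_le hs hy.le hu.le
    exact ⟨lt_of_mul_lt_mul_left (hu.trans_le (hMε.trans (min_le_left _ _))) hs.le,
      by linarith [min_le_right (s * ε) (ε / 3)]⟩
  · obtain ⟨M, hM, hMB, -, δ, hδ, hδB, hδM⟩ := hC.exists_pos_forall_small one_pos
    refine ⟨δ, hδ, fun φ ψ x v _ hnear hx => hx.tendsto_of_forall_le hC hc hM hMB fun t ht => ?_⟩
    have := hx.forall_lt_of_isNear hC hc hM hMB hδB hδM hnear t ht
    exact ⟨this.1.le, this.2.le⟩

/-- Either condition of the stability criterion yields a contraction factor. -/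
theorem exists_margin {a₀ A b₀ B τ : ℝ} (ha₀ : 0 < a₀) (hA : a₀ ≤ A) (hb₀ : 0 < b₀)
    (hτ : 0 ≤ τ)
    (hcond : (B ≤ a₀ ^ 2 / 4 ∧ a₀ / 2 * (A - a₀) < b₀ - a₀ * B * τ) ∨
      (a₀ / 2 * (A - a₀ / 2) ≤ b₀ ∧ B * (1 + a₀ * τ) < a₀ ^ 2 / 2)) :
    ∃ q < 1, ∀ α β, a₀ / 2 ≤ α → α ≤ A - a₀ / 2 → b₀ ≤ β → β ≤ B →
      |a₀ / 2 * α - β| / (a₀ / 2) + 2 * B * τ ≤ q * α := by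
  obtain ⟨s, rfl⟩ : ∃ s, a₀ = 2 * s := ⟨a₀ / 2, by ring⟩
  have hs : 0 < s := by linarith
  simp only [mul_div_cancel_left₀ _ (two_ne_zero' ℝ)] at hcond ⊢
  rcases hcond with ⟨h₁, h₂⟩ | ⟨h₁, h₂⟩
  -- Here `β ≤ s² ≤ s α`, so the absolute value opens as `s α - β`; the extreme case is `α = A - s`,
  -- `β = b₀`.
  · have hAs : 0 < A - s := by linarith
    have hκ : 0 < b₀ / s - 2 * B * τ := by
      rw [sub_pos, lt_div_iff₀ hs]
      nlinarith
    refine ⟨1 - (b₀ / s - 2 * B * τ) / (A - s), by linarith [div_pos hκ hAs],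
      fun α β hα hαA hβ₀ hβ => ?_⟩
    have hd : (b₀ / s - 2 * B * τ) / (A - s) * α ≤ b₀ / s - 2 * B * τ := by
      rw [div_mul_eq_mul_div, div_le_iff₀ hAs]
      gcongr
    have hβs : b₀ / s ≤ β / s := by gcongr
    rw [abs_of_nonneg (by nlinarith), sub_div, mul_div_cancel_left₀ _ hs.ne']
    linarith
  -- Here `s α ≤ s (A - s) ≤ β`, so the sign is reversed; the extreme case is `α = s`, `β = B`.
  · refine ⟨(B / s + 2 * B * τ) / s - 1, ?_, fun α β hα hαA hβ₀ hβ => ?_⟩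
    · rw [sub_lt_iff_lt_add, div_lt_iff₀ hs, ← sub_pos]
      have : (1 + 1) * s - (B / s + 2 * B * τ) = ((2 * s) ^ 2 / 2 - B * (1 + 2 * s * τ)) / s := by
        field_simp
        ring
      rw [this]
      exact div_pos (by linarith) hs
    · have hαβ : s * α ≤ β := by nlinarith
      have hβs : β / s ≤ B / s := by gcongr
      have hB : 0 < B := hb₀.trans_le (hβ₀.trans hβ)
      have hd : (B / s + 2 * B * τ) ≤ (B / s + 2 * B * τ) / s * α := by
        rw [div_mul_eq_mul_div, le_div_iff₀ hs]
        gcongr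
      rw [abs_of_nonpos (by linarith), neg_sub, sub_div, mul_div_cancel_left₀ _ hs.ne']
      linarith

/-! ### Existence of solutions with constant initial data -/

/-- Integrating against the exponential weight gains the factor `1 / L`, the source of the
contraction. -/
theorem abs_integral_le_mul_exp {f : ℝ → ℝ} {L C p q : ℝ} (hL : 0 < L) (hC : 0 ≤ C) (hpq : p ≤ q)
    (hf : ∀ s ∈ Ioc p q, |f s| ≤ C * Real.exp (L * (s - p))) :
    |∫ s in p..q, f s| ≤ C / L * Real.exp (L * (q - p)) := by
  have hder : ∀ s ∈ uIcc p q, HasDerivAt (fun s => C / L * Real.exp (L * (s - p)))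
      (C * Real.exp (L * (s - p))) s := fun s _ => by
    have := ((((hasDerivAt_id s).sub_const p).const_mul L).exp).const_mul (C / L)
    refine this.congr_deriv ?_
    simp only [id]
    field_simp
  have hint : IntervalIntegrable (fun s => C * Real.exp (L * (s - p))) volume p q :=
    Continuous.intervalIntegrable (by fun_prop) _ _
  have hle := intervalIntegral.norm_integral_le_of_norm_le hpq (f := f)
    (ae_of_all _ fun s hs => by simpa using hf s hs) hint
  rw [intervalIntegral.integral_eq_sub_of_hasDerivAt hder hint, Real.norm_eq_abs] at hle
  have : 0 ≤ C / L * Real.exp (L * (p - p)) := by positivity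
  linarith

/-- The position with initial value `p` whose velocity is `exp (L (t - t₀)) * w t`. -/
noncomputable def posOf (t₀ L p : ℝ) (w : ℝ → ℝ) (t : ℝ) : ℝ :=
  p + ∫ s in t₀..max t t₀, Real.exp (L * (s - t₀)) * w s

/-- The acceleration prescribed by the equation for the weighted velocity `w`. -/
noncomputable def accOf (a b h : ℝ → ℝ) (t₀ L p : ℝ) (w : ℝ → ℝ) (s : ℝ) : ℝ :=
  if t₀ < s then -(a s * (Real.exp (L * (s - t₀)) * w s) + b s * Real.sin (posOf t₀ L p w (h s)))
  else 0

/-- The velocity obtained by integrating the prescribed acceleration. -/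
noncomputable def velOf (a b h : ℝ → ℝ) (t₀ L p : ℝ) (w : ℝ → ℝ) (t : ℝ) : ℝ :=
  ∫ s in t₀..t, accOf a b h t₀ L p w s

section
variable {a b h : ℝ → ℝ} {t₀ L p A B C D t : ℝ} {w w' : ℝ → ℝ}

theorem continuous_posOf (hw : Continuous w) : Continuous (posOf t₀ L p w) := by
  have : Continuous fun t => ∫ s in t₀..t, Real.exp (L * (s - t₀)) * w s :=
    intervalIntegral.continuous_primitive
      (fun _ _ => Continuous.intervalIntegrable (by fun_prop) _ _) _
  exact continuous_const.add (this.comp (by fun_prop : Continuous fun t : ℝ => max t t₀))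

theorem posOf_of_le (ht : t ≤ t₀) : posOf t₀ L p w t = p := by
  simp [posOf, max_eq_right ht]

theorem hasDerivWithinAt_posOf (hw : Continuous w) (ht : t₀ ≤ t) :
    HasDerivWithinAt (posOf t₀ L p w) (Real.exp (L * (t - t₀)) * w t) (Ici t₀) t := by
  have hc : Continuous fun s => Real.exp (L * (s - t₀)) * w s := by fun_prop
  have := ((hc.integral_hasStrictDerivAt t₀ t).hasDerivAt.const_add p).hasDerivWithinAt
    (s := Ici t₀)
  refine this.congr (fun s hs => ?_) ?_
  · simp [posOf, max_eq_left (mem_Ici.1 hs)]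
  · simp [posOf, max_eq_left ht]

theorem abs_posOf_sub_le (hL : 0 < L) (hw : Continuous w) (hw' : Continuous w')
    (hD : ∀ s, |w s - w' s| ≤ D) :
    |posOf t₀ L p w t - posOf t₀ L p w' t| ≤ D / L * Real.exp (L * (max t t₀ - t₀)) := by
  have hD0 : 0 ≤ D := (abs_nonneg _).trans (hD 0)
  rw [posOf, posOf, add_sub_add_left_eq_sub, ← intervalIntegral.integral_sub
    (Continuous.intervalIntegrable (by fun_prop) _ _)
    (Continuous.intervalIntegrable (by fun_prop) _ _)]
  refine abs_integral_le_mul_exp hL hD0 (le_max_right _ _) fun s _ => ?_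
  rw [← mul_sub, abs_mul, Real.abs_exp, mul_comm]
  gcongr
  exact hD s

theorem measurable_accOf (ha : Measurable a) (hb : Measurable b) (hh : Measurable h)
    (hw : Continuous w) : Measurable (accOf a b h t₀ L p w) := by
  have h₁ : Measurable (posOf t₀ L p w) := (continuous_posOf hw).measurable
  have h₂ : Measurable w := hw.measurable
  exact Measurable.ite measurableSet_Ioi (by fun_prop) measurable_const

theorem abs_accOf_le (hL : 0 ≤ L) (ha : ∀ t, |a t| ≤ A) (hb : ∀ t, |b t| ≤ B)
    (hw : ∀ t, |w t| ≤ C) (s : ℝ) :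
    |accOf a b h t₀ L p w s| ≤ (A * C + B) * Real.exp (L * (s - t₀)) := by
  have hA : 0 ≤ A := (abs_nonneg _).trans (ha 0)
  have hB : 0 ≤ B := (abs_nonneg _).trans (hb 0)
  have hC : 0 ≤ C := (abs_nonneg _).trans (hw 0)
  rw [accOf]
  split_ifs with hs
  · have hexp : 1 ≤ Real.exp (L * (s - t₀)) :=
      Real.one_le_exp (mul_nonneg hL (by linarith))
    rw [abs_neg]
    calc _ ≤ |a s| * (Real.exp (L * (s - t₀)) * |w s|) +
          |b s| * |Real.sin (posOf t₀ L p w (h s))| := by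
            refine (abs_add_le _ _).trans_eq ?_
            rw [abs_mul, abs_mul, abs_mul, Real.abs_exp]
      _ ≤ A * (Real.exp (L * (s - t₀)) * C) + B * 1 := by
            gcongr
            · exact ha s
            · exact hw s
            · exact hb s
            · exact Real.abs_sin_le_one _
      _ ≤ A * (Real.exp (L * (s - t₀)) * C) + B * Real.exp (L * (s - t₀)) := by gcongr
      _ = _ := by ring
  · simp only [abs_zero]
    positivity

theorem locallyIntegrable_accOf (hL : 0 ≤ L) (ha : Measurable a) (hb : Measurable b)
    (hh : Measurable h) (hw : Continuous w) (ha' : ∀ t, |a t| ≤ A) (hb' : ∀ t, |b t| ≤ B)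
    (hw' : ∀ t, |w t| ≤ C) : LocallyIntegrable (accOf a b h t₀ L p w) := by
  have hc : Continuous fun s => (A * C + B) * Real.exp (L * (s - t₀)) := by fun_prop
  refine (hc.locallyIntegrable (μ := volume)).mono
    (measurable_accOf ha hb hh hw).aestronglyMeasurable (ae_of_all _ fun s => ?_)
  exact (abs_accOf_le hL ha' hb' hw' s).trans (le_abs_self _)

theorem abs_accOf_sub_le (hL : 0 < L) (ha : ∀ t, |a t| ≤ A) (hb : ∀ t, |b t| ≤ B)
    (hh : ∀ t, h t ≤ t) (hw : Continuous w) (hw' : Continuous w') (hD : ∀ s, |w s - w' s| ≤ D)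
    (s : ℝ) :
    |accOf a b h t₀ L p w s - accOf a b h t₀ L p w' s| ≤
      (A + B / L) * D * Real.exp (L * (s - t₀)) := by
  have hA : 0 ≤ A := (abs_nonneg _).trans (ha 0)
  have hB : 0 ≤ B := (abs_nonneg _).trans (hb 0)
  have hD0 : 0 ≤ D := (abs_nonneg _).trans (hD 0)
  rw [accOf, accOf]
  split_ifs with hs
  · have hsin : |Real.sin (posOf t₀ L p w (h s)) - Real.sin (posOf t₀ L p w' (h s))| ≤
        D / L * Real.exp (L * (s - t₀)) := by
      refine (Real.abs_sin_sub_sin_le _ _).trans ((abs_posOf_sub_le hL hw hw' hD).trans ?_)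
      gcongr
      -- Since `h s ≤ s`, the weight at the delayed time is no larger than at `s`.
      exact max_le (hh s) hs.le
    have hrw : -(a s * (Real.exp (L * (s - t₀)) * w s) + b s * Real.sin (posOf t₀ L p w (h s))) -
        -(a s * (Real.exp (L * (s - t₀)) * w' s) + b s * Real.sin (posOf t₀ L p w' (h s))) =
        -(a s * (Real.exp (L * (s - t₀)) * (w s - w' s)) +
          b s * (Real.sin (posOf t₀ L p w (h s)) - Real.sin (posOf t₀ L p w' (h s)))) := by ring
    rw [hrw, abs_neg]
    calc _ ≤ |a s| * (Real.exp (L * (s - t₀)) * |w s - w' s|) +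
          |b s| * |Real.sin (posOf t₀ L p w (h s)) - Real.sin (posOf t₀ L p w' (h s))| := by
            refine (abs_add_le _ _).trans_eq ?_
            rw [abs_mul, abs_mul, abs_mul, Real.abs_exp]
      _ ≤ A * (Real.exp (L * (s - t₀)) * D) + B * (D / L * Real.exp (L * (s - t₀))) := by
            gcongr
            · exact ha s
            · exact hD s
            · exact hb s
      _ = _ := by ring
  · simp only [sub_self, abs_zero]
    positivity

theorem velOf_of_le (ht : t ≤ t₀) : velOf a b h t₀ L p w t = 0 := by
  refine intervalIntegral.integral_zero_ae (ae_of_all _ fun s hs => ?_)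
  rw [uIoc_of_ge ht] at hs
  simp [accOf, not_lt.2 hs.2]

/-- Weighted bound for a quantity that vanishes up to `t₀` and grows at most like `exp (L (t - t₀))`
afterwards. -/
theorem exp_neg_mul_abs_le {V K : ℝ} (hL : 0 < L) (hK : 0 ≤ K) (h₀ : t ≤ t₀ → V = 0)
    (h₁ : t₀ ≤ t → |V| ≤ K / L * Real.exp (L * (t - t₀))) :
    |Real.exp (-(L * (t - t₀))) * V| ≤ K / L := by
  rcases le_total t t₀ with ht | ht
  · rw [h₀ ht, mul_zero, abs_zero]
    positivity
  · rw [abs_mul, Real.abs_exp]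
    calc _ ≤ Real.exp (-(L * (t - t₀))) * (K / L * Real.exp (L * (t - t₀))) := by
          gcongr
          exact h₁ ht
      _ = K / L * (Real.exp (-(L * (t - t₀))) * Real.exp (L * (t - t₀))) := by ring
      _ = K / L := by rw [← Real.exp_add]; simp

/-- Banach's fixed point theorem on bounded continuous weighted velocities. With `L = A + B + 1` the
constant `(A + B) / L` is below `1`, so the whole half-line is handled at once. -/
theorem exists_weighted_velocity (hA : 0 ≤ A) (hB : 0 ≤ B) (hL : L = A + B + 1)
    (ha : Measurable a) (hb : Measurable b) (hh : Measurable h) (ha' : ∀ t, |a t| ≤ A)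
    (hb' : ∀ t, |b t| ≤ B) (hh' : ∀ t, h t ≤ t) :
    ∃ w : ℝ → ℝ, Continuous w ∧ (∃ C, ∀ t, |w t| ≤ C) ∧
      ∀ t, velOf a b h t₀ L p w t = Real.exp (L * (t - t₀)) * w t := by
  have hL0 : 0 < L := by linarith
  have hbd : ∀ w : BoundedContinuousFunction ℝ ℝ, ∀ t, |w t| ≤ ‖w‖ := fun w t =>
    w.norm_coe_le_norm t
  have hloc : ∀ w : BoundedContinuousFunction ℝ ℝ, LocallyIntegrable (accOf a b h t₀ L p w) :=
    fun w => locallyIntegrable_accOf hL0.le ha hb hh w.continuous ha' hb' (hbd w)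
  have hii : ∀ w : BoundedContinuousFunction ℝ ℝ, ∀ c d : ℝ,
      IntervalIntegrable (accOf a b h t₀ L p w) volume c d := fun w c d =>
    intervalIntegrable_iff.2 (((hloc w).integrableOn_isCompact isCompact_uIcc).mono_set
      uIoc_subset_uIcc)
  let Φ : BoundedContinuousFunction ℝ ℝ → BoundedContinuousFunction ℝ ℝ := fun w =>
    BoundedContinuousFunction.ofNormedAddCommGroup
      (fun t => Real.exp (-(L * (t - t₀))) * velOf a b h t₀ L p w t)
      ((by fun_prop : Continuous fun t => Real.exp (-(L * (t - t₀)))).mul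
        (intervalIntegral.continuous_primitive (hii w) t₀))
      ((A * ‖w‖ + B) / L) fun t => exp_neg_mul_abs_le hL0 (by positivity) velOf_of_le fun ht =>
        abs_integral_le_mul_exp hL0 (by positivity) ht fun s _ =>
          abs_accOf_le hL0.le ha' hb' (hbd w) s
  have hK0 : 0 ≤ (A + B) / L := by positivity
  have hK : ContractingWith (NNReal.mk ((A + B) / L) hK0) Φ := by
    refine ⟨?_, LipschitzWith.of_dist_le_mul fun w w' => ?_⟩
    · rw [← NNReal.coe_lt_coe]
      exact (div_lt_one hL0).2 (by linarith)
    have hD : ∀ s, |w s - w' s| ≤ dist w w' := fun s => by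
      rw [← Real.dist_eq]
      exact BoundedContinuousFunction.dist_coe_le_dist s
    refine (BoundedContinuousFunction.dist_le (by positivity)).2 fun t => ?_
    change |Real.exp (-(L * (t - t₀))) * velOf a b h t₀ L p w t -
      Real.exp (-(L * (t - t₀))) * velOf a b h t₀ L p w' t| ≤ (A + B) / L * dist w w'
    have hBL : B / L ≤ B := div_le_self hB (by linarith)
    rw [← mul_sub]
    refine (exp_neg_mul_abs_le (K := (A + B / L) * dist w w') hL0 (by positivity)
      (fun ht => by rw [velOf_of_le ht, velOf_of_le ht, sub_zero]) fun ht => ?_).trans ?_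
    · rw [velOf, velOf, ← intervalIntegral.integral_sub (hii w _ _) (hii w' _ _)]
      exact abs_integral_le_mul_exp hL0 (by positivity) ht fun s _ =>
        abs_accOf_sub_le hL0 ha' hb' hh' w.continuous w'.continuous hD s
    · rw [mul_div_right_comm]
      gcongr
  obtain ⟨w, hw⟩ : ∃ w, Φ w = w := ⟨_, hK.fixedPoint_isFixedPt⟩
  refine ⟨w, w.continuous, ⟨‖w‖, hbd w⟩, fun t => ?_⟩
  have : Real.exp (-(L * (t - t₀))) * velOf a b h t₀ L p w t = w t := DFunLike.congr_fun hw t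
  rw [← this, ← mul_assoc, ← Real.exp_add]
  simp

/-- Global existence for constant initial position and zero initial velocity. -/
theorem exists_isSolution_of_measurable (ha : Measurable a) (hb : Measurable b) (hh : Measurable h)
    (ha' : ∀ t, |a t| ≤ A) (hb' : ∀ t, |b t| ≤ B) (hh' : ∀ t, h t ≤ t) (t₀ p : ℝ) :
    ∃ x v, IsSolution a b h t₀ (fun _ => p) (fun _ => 0) x v := by
  have hA : 0 ≤ A := (abs_nonneg _).trans (ha' 0)
  have hB : 0 ≤ B := (abs_nonneg _).trans (hb' 0)
  obtain ⟨w, hw, ⟨C, hC⟩, hvel⟩ := exists_weighted_velocity (t₀ := t₀) (p := p) hA hB rfl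
    ha hb hh ha' hb' hh'
  have hloc : LocallyIntegrable (accOf a b h t₀ (A + B + 1) p w) :=
    locallyIntegrable_accOf (by positivity) ha hb hh hw ha' hb' hC
  refine ⟨posOf t₀ (A + B + 1) p w, velOf a b h t₀ (A + B + 1) p w, fun t ht => posOf_of_le ht,
    fun t ht => velOf_of_le ht, fun t ht => ?_, fun T hT => ?_, ?_⟩
  · rw [hvel]
    exact hasDerivWithinAt_posOf hw ht
  · have : IntervalIntegrable (accOf a b h t₀ (A + B + 1) p w) volume t₀ T :=
      intervalIntegrable_iff.2 ((hloc.integrableOn_isCompact isCompact_uIcc).mono_set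
        uIoc_subset_uIcc)
    exact this.absolutelyContinuousOnInterval_intervalIntegral left_mem_uIcc
  -- The null point `t₀` is dropped because `accOf` is set to `0` there; elsewhere Lebesgue
  -- differentiation applies.
  · rw [← restrict_Ioi_eq_restrict_Ici, ae_restrict_iff' measurableSet_Ioi]
    filter_upwards [LocallyIntegrable.ae_hasDerivAt_integral hloc] with t ht htt
    refine ⟨_, ht t₀, ?_⟩
    rw [accOf, if_pos (mem_Ioi.1 htt), hvel]
    ring

end

theorem IsSolution.congr_ae {a b h a' b' h' φ ψ x v : ℝ → ℝ} {t₀ : ℝ}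
    (hx : IsSolution a b h t₀ φ ψ x v)
    (heq : ∀ᵐ t ∂(volume.restrict (Ici t₀)), a t = a' t ∧ b t = b' t ∧ h t = h' t) :
    IsSolution a' b' h' t₀ φ ψ x v := by
  refine ⟨hx.init_pos, hx.init_vel, hx.hasDeriv, hx.absCont, ?_⟩
  filter_upwards [hx.equation, heq] with t ht he
  rwa [he.1, he.2.1, he.2.2] at ht

/-- Clamped Borel versions of the coefficients satisfy the bounds everywhere and agree with the
originals almost everywhere, so they have the same solutions. -/
theorem exists_isSolution {a b h : ℝ → ℝ} {A B t₀ : ℝ} (hA : 0 ≤ A) (hB : 0 ≤ B)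
    (ha : AEMeasurable a (volume.restrict (Ici t₀)))
    (hb : AEMeasurable b (volume.restrict (Ici t₀)))
    (hh : AEMeasurable h (volume.restrict (Ici t₀)))
    (hbd : ∀ᵐ t ∂(volume.restrict (Ici t₀)), (0 ≤ a t ∧ a t ≤ A) ∧ (0 ≤ b t ∧ b t ≤ B) ∧ h t ≤ t)
    (p : ℝ) : ∃ x v, IsSolution a b h t₀ (fun _ => p) (fun _ => 0) x v := by
  have clamp : ∀ {r s : ℝ}, 0 ≤ r → |max 0 (min r s)| ≤ r := fun {r s} hr => by
    rw [abs_of_nonneg (le_max_left _ _)]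
    exact max_le hr (min_le_left _ _)
  have hma := ha.measurable_mk
  have hmb := hb.measurable_mk
  have hmh := hh.measurable_mk
  obtain ⟨x, v, hx⟩ := exists_isSolution_of_measurable (a := fun t => max 0 (min A (ha.mk a t)))
    (b := fun t => max 0 (min B (hb.mk b t))) (h := fun t => min t (hh.mk h t))
    (by fun_prop) (by fun_prop) (by fun_prop) (fun _ => clamp hA) (fun _ => clamp hB)
    (fun _ => min_le_left _ _) t₀ p
  refine ⟨x, v, hx.congr_ae ?_⟩
  filter_upwards [ha.ae_eq_mk, hb.ae_eq_mk, hh.ae_eq_mk, hbd] with t h₁ h₂ h₃ h₄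
  rw [← h₁, ← h₂, ← h₃, min_eq_right h₄.1.2, min_eq_right h₄.2.1.2, min_eq_right h₄.2.2,
    max_eq_right h₄.1.1, max_eq_right h₄.2.1.1]
  exact ⟨rfl, rfl, rfl⟩

/-! ### Instability of the odd multiples of `π` -/

/-- Released at rest on the right of an odd multiple of `π`, a solution that stays close to it
never moves back towards it. -/
theorem IsSolution.le_of_const_of_abs_lt_one {a b h x v : ℝ → ℝ} {t₀ c d : ℝ} (hd : 0 < d)
    (hx : IsSolution a b h t₀ (fun _ => c + d) (fun _ => 0) x v)
    (hc : ∀ y, Real.sin y = -Real.sin (y - c))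
    (hbd : ∀ᵐ t ∂(volume.restrict (Ici t₀)), 0 ≤ a t ∧ 0 ≤ b t ∧ h t ≤ t)
    (hclose : ∀ t ≥ t₀, |x t - c| < 1) : ∀ t ≥ t₀, c + d ≤ x t := by
  have heq := hx.equation
  rw [ae_restrict_iff' measurableSet_Ici] at heq hbd
  have hd1 : d < 1 := by
    have := hclose t₀ le_rfl
    rw [hx.init_pos t₀ le_rfl, add_sub_cancel_left] at this
    exact (le_abs_self d).trans_lt this
  -- While `x > c`, the delayed displacement lies in `[0, 1]`, inside `[0, π]`. The sine term then
  -- pushes outward, and wherever `v < 0` the damping does too, so `v` never becomes negative.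
  have step : ∀ r ≥ t₀, (∀ t ∈ Ico t₀ r, c - x t < 0) → c + d ≤ x r := by
    intro r hr hpos
    have hvel : ∀ r' ∈ Icc t₀ r, -v r' ≤ 0 := fun r' hr' =>
      le_of_ae_hasDerivAt_nonpos_above (g := -v) hr'.1 (hx.absCont r' hr'.1).neg
        (by simp [hx.init_vel t₀ le_rfl]) (by
          filter_upwards [heq, hbd] with t heqt hbdt hmem hlt
          obtain ⟨w, hw, hweq⟩ := heqt hmem.1.le
          obtain ⟨ha, hb, hh⟩ := hbdt hmem.1.le
          refine ⟨-w, hw.neg, ?_⟩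
          have hu : 0 ≤ x (h t) - c ∧ x (h t) - c ≤ 1 := by
            rcases le_or_gt t₀ (h t) with hth | hth
            · have h₁ := hpos (h t) ⟨hth, hh.trans_lt (hmem.2.trans_le hr'.2)⟩
              exact ⟨by linarith, (le_abs_self _).trans (hclose _ hth).le⟩
            · rw [hx.init_pos _ hth.le]
              constructor <;> linarith
          have hsin : 0 ≤ Real.sin (x (h t) - c) :=
            Real.sin_nonneg_of_nonneg_of_le_pi hu.1 (by linarith [Real.pi_gt_three])
          rw [hc] at hweq
          have h₁ := mul_nonneg hb hsin
          have h₂ := mul_nonneg ha (show 0 ≤ -v t from hlt.le)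
          linarith)
    have := le_sub_mul_of_ae_hasDerivAt_le (g := -x) (κ := 0) hr (hx.absCont_pos hr).neg
      (ae_of_all _ fun t ht => ⟨-v t, (hx.hasDerivAt_pos ht.1).neg,
        by simpa using hvel t ⟨ht.1.le, ht.2.le⟩⟩)
    have h₀ := hx.init_pos t₀ le_rfl
    simp only [Pi.neg_apply] at this
    linarith
  have hcont : ContinuousOn (fun t => c - x t) (Ici t₀) := continuousOn_const.sub hx.continuousOn_pos
  have hall := forall_lt_of_no_first_exit hcont (M := 0) fun r hr hlt => by
    linarith [step r hr hlt]
  exact fun t ht => step t ht fun r hr => hall r hr.1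

/-- Stability with `ε = 1` confines a solution released at rest near `c`; it then stays beyond `c +
d`, contradicting attractivity. -/
theorem not_isLocallyAsymptoticallyStable {a b h : ℝ → ℝ} {A B t₀ c : ℝ} (hA : 0 ≤ A) (hB : 0 ≤ B)
    (ha : AEMeasurable a (volume.restrict (Ici t₀)))
    (hb : AEMeasurable b (volume.restrict (Ici t₀)))
    (hh : AEMeasurable h (volume.restrict (Ici t₀)))
    (hbd : ∀ᵐ t ∂(volume.restrict (Ici t₀)), (0 ≤ a t ∧ a t ≤ A) ∧ (0 ≤ b t ∧ b t ≤ B) ∧ h t ≤ t)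
    (hc : ∀ y, Real.sin y = -Real.sin (y - c)) :
    ¬ IsLocallyAsymptoticallyStable a b h t₀ c := by
  rintro ⟨hstab, δ₁, hδ₁, hattr⟩
  obtain ⟨δ₂, hδ₂, hstab⟩ := hstab 1 one_pos
  obtain ⟨d, hd, hdδ⟩ := exists_between (lt_min hδ₁ hδ₂)
  obtain ⟨x, v, hx⟩ := exists_isSolution hA hB ha hb hh hbd (c + d)
  have hinit : IsInitialData t₀ (fun _ => c + d) (fun _ => 0) :=
    ⟨measurable_const, measurable_const, ⟨_, fun _ _ => le_rfl⟩, ⟨_, fun _ _ => le_rfl⟩⟩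
  have hnear : ∀ δ, d < δ → IsNear t₀ c δ (fun _ => c + d) (fun _ => 0) := fun δ hδ _ _ => by
    simp only [add_sub_cancel_left, abs_of_pos hd, abs_zero]
    exact ⟨hδ, hd.trans hδ⟩
  have hclose := hstab _ _ x v hinit (hnear δ₂ (hdδ.trans_le (min_le_right _ _))) hx
  have hlim := (hattr _ _ x v hinit (hnear δ₁ (hdδ.trans_le (min_le_left _ _))) hx).1
  have hge := hx.le_of_const_of_abs_lt_one hd hc
    (hbd.mono fun t ht => ⟨ht.1.1, ht.2.1.1, ht.2.2⟩) fun t ht => (hclose t ht).1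
  have := ge_of_tendsto hlim ((eventually_ge_atTop t₀).mono hge)
  linarith

theorem isEquilibrium_of_sin_eq_zero {a b h : ℝ → ℝ} {c : ℝ} (hc : Real.sin c = 0) :
    IsEquilibrium a b h c := fun t₀ _ =>
  ⟨fun _ _ => rfl, fun _ _ => rfl, fun _ _ => hasDerivWithinAt_const _ _ _,
    fun _ _ => by simp [AbsolutelyContinuousOnInterval, tendsto_const_nhds],
    ae_of_all _ fun t => ⟨0, hasDerivAt_const _ _, by simp [hc]⟩⟩

end Sunflower

theorem mainTheorem9 (a b h : ℝ → ℝ) (a₀ A b₀ B τ : ℝ)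
    (ha_meas : AEMeasurable a (volume.restrict (Ici (0 : ℝ))))
    (hb_meas : AEMeasurable b (volume.restrict (Ici (0 : ℝ))))
    (hh_meas : AEMeasurable h (volume.restrict (Ici (0 : ℝ))))
    (ha₀ : 0 < a₀) (hb₀ : 0 < b₀)
    (ha : ∀ᵐ t ∂(volume.restrict (Ici (0 : ℝ))), a₀ ≤ a t ∧ a t ≤ A)
    (hb : ∀ᵐ t ∂(volume.restrict (Ici (0 : ℝ))), b₀ ≤ b t ∧ b t ≤ B)
    (hh : ∀ᵐ t ∂(volume.restrict (Ici (0 : ℝ))), h t ≤ t ∧ t - h t ≤ τ)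
    (hcond : (B ≤ a₀ ^ 2 / 4 ∧ a₀ / 2 * (A - a₀) < b₀ - a₀ * B * τ) ∨
      (a₀ / 2 * (A - a₀ / 2) ≤ b₀ ∧ B * (1 + a₀ * τ) < a₀ ^ 2 / 2)) :
    (∀ k : ℤ, Sunflower.IsEquilibrium a b h (2 * k * Real.pi) ∧
      ∀ t₀ ≥ (0 : ℝ), Sunflower.IsLocallyAsymptoticallyStable a b h t₀ (2 * k * Real.pi)) ∧
    (∀ k : ℤ, Sunflower.IsEquilibrium a b h ((2 * k + 1) * Real.pi) ∧
      ∀ t₀ ≥ (0 : ℝ),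
        ¬ Sunflower.IsLocallyAsymptoticallyStable a b h t₀ ((2 * k + 1) * Real.pi)) := by
  -- One time at which all bounds hold yields `a₀ ≤ A`, `b₀ ≤ B` and `0 ≤ τ`.
  have hne : NeBot (ae (volume.restrict (Ici (0 : ℝ)))) := by
    rw [ae_neBot, Ne, Measure.restrict_eq_zero, Real.volume_Ici]
    exact ENNReal.top_ne_zero
  obtain ⟨t₁, hat, hbt, hht⟩ := (ha.and (hb.and hh)).exists
  have hA : a₀ ≤ A := hat.1.trans hat.2
  have hB : b₀ ≤ B := hbt.1.trans hbt.2
  have hτ : 0 ≤ τ := by linarith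
  have hsin : ∀ (k : ℤ) (y : ℝ), Real.sin (y - 2 * k * Real.pi) = Real.sin y := fun k y => by
    rw [← Real.sin_sub_int_mul_two_pi y k]
    ring_nf
  have hrestr : ∀ t₀ ≥ (0 : ℝ), volume.restrict (Ici t₀) ≤ volume.restrict (Ici (0 : ℝ)) :=
    fun t₀ ht₀ => Measure.restrict_mono_set _ (Ici_subset_Ici.2 ht₀)
  refine ⟨fun k => ⟨Sunflower.isEquilibrium_of_sin_eq_zero ?_, fun t₀ ht₀ => ?_⟩,
    fun k => ⟨Sunflower.isEquilibrium_of_sin_eq_zero ?_, fun t₀ ht₀ => ?_⟩⟩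
  · simpa using (hsin k (2 * k * Real.pi)).symm
  · obtain ⟨q, hq, hmargin⟩ := Sunflower.exists_margin ha₀ hA hb₀ hτ hcond
    -- The margin inequality at `α = a₀ / 2`, `β = b₀` bounds a nonnegative quantity by `q α`, which
    -- forces `q ≥ 0`.
    have hq0 : 0 ≤ q := by
      have h₁ := hmargin (a₀ / 2) b₀ le_rfl (by linarith) le_rfl hB
      have h₂ : 0 ≤ |a₀ / 2 * (a₀ / 2) - b₀| / (a₀ / 2) + 2 * B * τ := by
        have : 0 < B := by linarith
        positivity
      exact nonneg_of_mul_nonneg_left (h₂.trans h₁) (by linarith)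
    have hC : Sunflower.IsContractive a b h (a₀ / 2) B τ q t₀ := by
      refine ⟨by linarith, by linarith, hτ, hq0, hq, ?_⟩
      have hall := ha.and (hb.and hh)
      rw [ae_restrict_iff' measurableSet_Ici] at hall
      filter_upwards [hall] with t ht htt
      obtain ⟨h₁, h₂, h₃⟩ := ht (ht₀.le.trans htt)
      exact ⟨by linarith, by linarith, h₂.2,
        hmargin _ _ (by linarith) (by linarith) h₂.1 h₂.2, h₃.1, h₃.2⟩
    exact hC.isLocallyAsymptoticallyStable fun y => (hsin k y).symm
  · rw [add_mul, one_mul, Real.sin_add_pi]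
    simpa using (hsin k (2 * k * Real.pi)).symm
  · refine Sunflower.not_isLocallyAsymptoticallyStable (A := A) (B := B) (by linarith) (by linarith)
      (ha_meas.mono_measure (hrestr t₀ ht₀)) (hb_meas.mono_measure (hrestr t₀ ht₀))
      (hh_meas.mono_measure (hrestr t₀ ht₀)) ?_ fun y => ?_
    · filter_upwards [ae_mono (hrestr t₀ ht₀) ha, ae_mono (hrestr t₀ ht₀) hb,
        ae_mono (hrestr t₀ ht₀) hh] with t h₁ h₂ h₃
      exact ⟨⟨by linarith, h₁.2⟩, ⟨by linarith, h₂.2⟩, h₃.1⟩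
    · rw [add_mul, one_mul, ← sub_sub, Real.sin_sub_pi, neg_neg, hsin]
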